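/- Let $S$ be a connected Riemann surface and $\alpha\not\equiv 0$ a holomorphic $1$-form on $S$. Assume that the translation surface $(S,\alpha)$ has finite area and that $S$ has infinite topological type (its fundamental group is not finitely generated). $\mathrm{SL}(2,\mathbb R)$ acts on translation surfaces by postcomposing the local coordinates $q\mapsto\int^q\alpha$ with real-linear maps of $\mathbb C=\mathbb R^2$; two surfaces are *translation equivalent* if there is a homeomorphism between them which is a translation in local coordinates. Put $g^t=\mathrm{diag}(e^{-t},e^{t})$. Let $\mathcal O(S,\alpha)=\{A(S,\alpha): A\in \mathrm{SL}(2,\mathbb R)\}/\text{translation equivalence}$, with the quotient topology from $\mathrm{SL}(2,\mathbb R)$. Fix $d\ge 2$, a subgroup $G$ of the symmetric group $\Pi_d$ and a basepoint $s_0\in S$. A (possibly disconnected, unbranched) cover of $S$ of degree $d$ has *monodromy in $G$* if, for some labelling of the fibre over $s_0$ by $\{1,\dots,d\}$, its monodromy representation $\pi_1(S,s_0)\to\Pi_d$ takes values in $G$. Let $\mathrm{Cov}_G(S,\alpha)$ be the set of such covers, with the lifted translation structure, up to translation equivalence. It carries the quotient topology from $\mathrm{Hom}(\pi_1(S,s_0),G)$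 with the topology of pointwise convergence. Let $\tilde{\mathcal O}_G(S,\alpha)=\{A(\tilde S,\tilde\alpha): A\in \mathrm{SL}(2,\mathbb R),\ (\tilde S,\tilde\alpha)\in \mathrm{Cov}_G(S,\alpha)\}/\text{translation equivalence}$, with the quotient topology from $\mathrm{SL}(2,\mathbb R)\times \mathrm{Cov}_G(S,\alpha)$. Suppose that the Teichmüller trajectory of $(S,\alpha)$ is non-divergent in $\mathcal O(S,\alpha)$, that is, $g^{t_n}(S,\alpha)$ converges in $\mathcal O(S,\alpha)$ for some sequence $t_n\to+\infty$. Then for every cover $(\tilde S,\tilde\alpha)$ of $(S,\alpha)$ of degree $d$ with monodromy in $G$, the trajectory $g^t(\tilde S,\tilde\alpha)$ has an $\omega$-limit point in $\tilde{\mathcal O}_G(S,\alpha)$: there are a sequence $t_n\to+\infty$ and a point $y\in\tilde{\mathcal O}_G(S,\alpha)$ such that $g^{t_n}(\tilde S,\tilde\alpha)\to y$. -/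

import Mathlib

open scoped Manifold ContDiff Topology MatrixGroups
open Filter

universe u

noncomputable section

namespace Flat

/-! ### Translation structures -/

/-- The real-linear action of a matrix on the plane `ℂ = ℝ²`:
`x + iy ↦ (a₁₁ x + a₁₂ y) + i (a₂₁ x + a₂₂ y)`. -/
def planeMap (A : SL(2, ℝ)) (z : ℂ) : ℂ :=
  ⟨A.1 0 0 * z.re + A.1 0 1 * z.im, A.1 1 0 * z.re + A.1 1 1 * z.im⟩

theorem planeMap_add (A : SL(2, ℝ)) (z w : ℂ) :
    planeMap A (z + w) = planeMap A z + planeMap A w := by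
  apply Complex.ext <;> simp [planeMap] <;> ring

theorem planeMap_one (z : ℂ) : planeMap 1 z = z := by
  apply Complex.ext <;> simp [planeMap]

theorem planeMap_mul (A B : SL(2, ℝ)) (z : ℂ) :
    planeMap (A * B) z = planeMap A (planeMap B z) := by
  apply Complex.ext <;> simp [planeMap, Matrix.mul_apply, Fin.sum_univ_two] <;> ring

theorem planeMap_inv (A : SL(2, ℝ)) (z : ℂ) : planeMap A (planeMap A⁻¹ z) = z := by
  rw [← planeMap_mul, mul_inv_cancel, planeMap_one]

/-- A system of local `ℂ`-valued coordinates, well defined up to translation. `IsCoord p f` says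
that `f`, near `p`, is one of the local coordinates `q ↦ ∫ α` (integral from a fixed nearby point
to `q`) determined by a `1`-form `α`. At a zero of `α` the coordinate is branched. The structures
used below are the one of a Riemann surface with a holomorphic `1`-form, its lifts to covers, and
the images of these under `SL(2,ℝ)`. -/
@[ext]
structure TranslationStructure (X : Type u) [TopologicalSpace X] where
  IsCoord : X → (X → ℂ) → Prop
  exists_coord : ∀ p, ∃ f, IsCoord p f
  isCoord_iff : ∀ {p f}, IsCoord p f →
    ∀ g, IsCoord p g ↔ ∃ c : ℂ, g =ᶠ[𝓝 p] fun q => f q + c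
  eventually_isCoord : ∀ {p f}, IsCoord p f → ∀ᶠ q in 𝓝 p, IsCoord q f

namespace TranslationStructure

variable {X : Type u} [TopologicalSpace X]

/-- `A ∈ SL(2,ℝ)` acts by postcomposing all local coordinates with `A`. -/
instance : SMul SL(2, ℝ) (TranslationStructure X) where
  smul A T :=
    { IsCoord := fun p g => ∃ f, T.IsCoord p f ∧ g = planeMap A ∘ f
      exists_coord := fun p => by
        obtain ⟨f, hf⟩ := T.exists_coord p
        exact ⟨_, f, hf, rfl⟩
      isCoord_iff := by
        rintro p _ ⟨f, hf, rfl⟩ g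
        constructor
        · rintro ⟨f', hf', rfl⟩
          obtain ⟨c, hc⟩ := (T.isCoord_iff hf f').1 hf'
          refine ⟨planeMap A c, ?_⟩
          filter_upwards [hc] with q hq
          simp [hq, planeMap_add]
        · rintro ⟨c, hc⟩
          refine ⟨planeMap A⁻¹ ∘ g, (T.isCoord_iff hf _).2 ⟨planeMap A⁻¹ c, ?_⟩, ?_⟩
          · filter_upwards [hc] with q hq
            simp only [Function.comp_apply, hq, planeMap_add, ← planeMap_mul, inv_mul_cancel,
              planeMap_one]
          · funext q
            simp [planeMap_inv]
      eventually_isCoord := by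
        rintro p _ ⟨f, hf, rfl⟩
        filter_upwards [T.eventually_isCoord hf] with q hq
        exact ⟨f, hq, rfl⟩ }

theorem smul_isCoord (A : SL(2, ℝ)) (T : TranslationStructure X) (p : X) (g : X → ℂ) :
    (A • T).IsCoord p g ↔ ∃ f, T.IsCoord p f ∧ g = planeMap A ∘ f := Iff.rfl

instance : MulAction SL(2, ℝ) (TranslationStructure X) where
  one_smul T := by
    ext p g
    rw [smul_isCoord]
    constructor
    · rintro ⟨f, hf, rfl⟩
      convert hf
      funext q
      exact planeMap_one _
    · intro hg
      exact ⟨g, hg, funext fun q => (planeMap_one _).symm⟩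
  mul_smul A B T := by
    ext p g
    simp only [smul_isCoord]
    constructor
    · rintro ⟨f, hf, rfl⟩
      exact ⟨_, ⟨f, hf, rfl⟩, funext fun q => planeMap_mul _ _ _⟩
    · rintro ⟨_, ⟨f, hf, rfl⟩, rfl⟩
      exact ⟨f, hf, funext fun q => (planeMap_mul _ _ _).symm⟩

/-- The lift of a translation structure along a covering map `p : E → X`: the local coordinates
upstairs are the coordinates downstairs composed with `p`. -/
def lift {E : Type u} [TopologicalSpace E] (T : TranslationStructure X) {p : E → X}
    (hp : IsCoveringMap p) : TranslationStructure E where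
  IsCoord e g := ∃ f, T.IsCoord (p e) f ∧ g =ᶠ[𝓝 e] f ∘ p
  exists_coord e := by
    obtain ⟨f, hf⟩ := T.exists_coord (p e)
    exact ⟨_, f, hf, EventuallyEq.rfl⟩
  isCoord_iff := by
    rintro e g ⟨f, hf, hg⟩ g'
    constructor
    · rintro ⟨f', hf', hg'⟩
      obtain ⟨c, hc⟩ := (T.isCoord_iff hf f').1 hf'
      refine ⟨c, ?_⟩
      filter_upwards [hg, hg', hp.continuous.continuousAt.eventually hc] with q h1 h2 h3
      rw [h1, h2]
      exact h3
    · rintro ⟨c, hc⟩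
      refine ⟨fun q => f q + c, (T.isCoord_iff hf _).2 ⟨c, EventuallyEq.rfl⟩, ?_⟩
      filter_upwards [hg, hc] with q h1 h2
      rw [h2, h1]
      rfl
  eventually_isCoord := by
    rintro e g ⟨f, hf, hg⟩
    filter_upwards [eventually_eventually_nhds.2 hg,
      hp.continuous.continuousAt.eventually (T.eventually_isCoord hf)] with q h1 h2
    exact ⟨f, h2, h1⟩

/-- The total Lebesgue area in the local coordinates: the supremum of the areas of finite families
of pairwise disjoint open sets, each carrying an injective local coordinate. -/
def area (T : TranslationStructure X) : ENNReal :=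
  ⨆ (n : ℕ) (U : Fin n → Set X) (f : Fin n → X → ℂ)
    (_ : Pairwise (Function.onFun Disjoint U))
    (_ : ∀ i, IsOpen (U i) ∧ Set.InjOn (f i) (U i) ∧ ∀ q ∈ U i, T.IsCoord q (f i)),
    ∑ i, MeasureTheory.volume (f i '' U i)

end TranslationStructure

/-! ### Riemann surfaces with a holomorphic one-form -/

section Form

variable {S : Type u} [TopologicalSpace S] [ChartedSpace ℂ S] [IsManifold 𝓘(ℂ) ω S]

/-- Holomorphic `1`-forms on a Riemann surface: holomorphic sections of the bundle of complex
linear functionals on the holomorphic tangent spaces. -/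
abbrev HolomorphicOneForm (S : Type u) [TopologicalSpace S] [ChartedSpace ℂ S]
    [IsManifold 𝓘(ℂ) ω S] : Type u :=
  letI : IsManifold 𝓘(ℂ) 1 S := IsManifold.of_le (n := ω) le_top
  ContMDiffSection 𝓘(ℂ) (ℂ →L[ℂ] ℂ) ω
    (fun x : S => TangentSpace 𝓘(ℂ) x →L[ℂ] Bundle.Trivial S ℂ x)

/-- `f` is a local primitive of `α` near `p`: `df = α` on a neighbourhood of `p`. -/
def IsPrimitiveAt (α : HolomorphicOneForm S) (p : S) (f : S → ℂ) : Prop :=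
  ∀ᶠ q in 𝓝 p, HasMFDerivAt 𝓘(ℂ) 𝓘(ℂ) f q (α q)

theorem hasMFDerivAt_zero_const {p : S} {h : S → ℂ}
    (hh : ∀ᶠ q in 𝓝 p, HasMFDerivAt 𝓘(ℂ) 𝓘(ℂ) h q 0) : ∃ c : ℂ, ∀ᶠ q in 𝓝 p, h q = c := by
  have : IsManifold 𝓘(ℂ) 1 S := IsManifold.of_le (n := ω) le_top
  have hcont := continuousAt_extChartAt_symm (I := 𝓘(ℂ)) p
  have hleft : (extChartAt 𝓘(ℂ) p).symm (extChartAt 𝓘(ℂ) p p) = p := extChartAt_to_inv p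
  have h1 : ∀ᶠ z in 𝓝 (extChartAt 𝓘(ℂ) p p),
      HasMFDerivAt 𝓘(ℂ) 𝓘(ℂ) h ((extChartAt 𝓘(ℂ) p).symm z) 0 :=
    hcont.eventually (by rw [hleft]; exact hh)
  obtain ⟨r, hr, hball⟩ := Metric.eventually_nhds_iff_ball.1
    (h1.and (extChartAt_target_mem_nhds (I := 𝓘(ℂ)) p))
  have hd : ∀ z ∈ Metric.ball (extChartAt 𝓘(ℂ) p p) r,
      HasFDerivAt (h ∘ (extChartAt 𝓘(ℂ) p).symm) (0 : ℂ →L[ℂ] ℂ) z := by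
    intro z hz
    have h2 := (mdifferentiableOn_extChartAt_symm (I := 𝓘(ℂ)) z (hball z hz).2).mdifferentiableAt
      ((isOpen_extChartAt_target p).mem_nhds (hball z hz).2)
    have h3 := HasMFDerivAt.comp z (hball z hz).1 h2.hasMFDerivAt
    have h4 := hasMFDerivAt_iff_hasFDerivAt.1 h3
    have h5 : (0 : ℂ →L[ℂ] ℂ).comp (mfderiv 𝓘(ℂ) 𝓘(ℂ) (extChartAt 𝓘(ℂ) p).symm z) = 0 :=
      ContinuousLinearMap.zero_comp _
    exact h5 ▸ h4
  obtain ⟨c, hc⟩ := Metric.isOpen_ball.exists_is_const_of_fderiv_eq_zero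
    (convex_ball (extChartAt 𝓘(ℂ) p p) r).isPreconnected
    (fun z hz => (hd z hz).differentiableAt.differentiableWithinAt)
    (fun z hz => (hd z hz).fderiv)
  refine ⟨c, ?_⟩
  filter_upwards [(continuousAt_extChartAt (I := 𝓘(ℂ)) p).eventually (Metric.ball_mem_nhds _ hr),
    extChartAt_source_mem_nhds (I := 𝓘(ℂ)) p] with q h5 h6
  have h7 := hc _ h5
  rwa [Function.comp_apply, (extChartAt 𝓘(ℂ) p).left_inv h6] at h7

theorem exists_isPrimitiveAt (α : HolomorphicOneForm S) (p : S) : ∃ f, IsPrimitiveAt α p f := by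
  have : IsManifold 𝓘(ℂ) 1 S := IsManifold.of_le (n := ω) le_top
  have h := ((contMDiffAt_hom_bundle _).1 (α.contMDiff p)).2
  set b : S → (ℂ →L[ℂ] ℂ) := fun x => ContinuousLinearMap.inCoordinates ℂ
    (fun x : S => TangentSpace 𝓘(ℂ) x) ℂ (Bundle.Trivial S ℂ) p x p x (α x) with hb
  have hbα : ∀ x ∈ (chartAt ℂ p).source, ∀ v : TangentSpace 𝓘(ℂ) x,
      b x (mfderiv 𝓘(ℂ) 𝓘(ℂ) (extChartAt 𝓘(ℂ) p) x v) = α x v := by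
    intro x hx v
    have h1 : mfderiv 𝓘(ℂ) 𝓘(ℂ) (extChartAt 𝓘(ℂ) p) x v =
        (trivializationAt ℂ (fun x : S => TangentSpace 𝓘(ℂ) x) p).continuousLinearMapAt ℂ x v := by
      rw [TangentBundle.continuousLinearMapAt_trivializationAt hx]
      rfl
    have hx' : x ∈ (trivializationAt ℂ (fun x : S => TangentSpace 𝓘(ℂ) x) p).baseSet := hx
    rw [h1, hb]
    simp only [ContinuousLinearMap.inCoordinates, ContinuousLinearMap.comp_apply]
    rw [Bundle.Trivialization.symmL_continuousLinearMapAt _ hx']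
    have h2 := Bundle.Trivial.continuousLinearMapAt_trivialization ℂ S ℂ x
    exact congrArg (fun l : ℂ →L[ℂ] ℂ => l (α x v)) h2
  have h1 : ∀ᶠ x in 𝓝 p, ContMDiffAt 𝓘(ℂ) 𝓘(ℂ, ℂ →L[ℂ] ℂ) 1 b x :=
    (contMDiffAt_iff_contMDiffAt_nhds (by simp)).1 (ContMDiffAt.of_le h le_top)
  have hcont := continuousAt_extChartAt_symm (I := 𝓘(ℂ)) p
  have hleft : (extChartAt 𝓘(ℂ) p).symm (extChartAt 𝓘(ℂ) p p) = p := extChartAt_to_inv p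
  have h2 : ∀ᶠ z in 𝓝 (extChartAt 𝓘(ℂ) p p),
      ContMDiffAt 𝓘(ℂ) 𝓘(ℂ, ℂ →L[ℂ] ℂ) 1 b ((extChartAt 𝓘(ℂ) p).symm z) :=
    hcont.eventually (by rw [hleft]; exact h1)
  obtain ⟨r, hr, hball⟩ := Metric.eventually_nhds_iff_ball.1
    (h2.and (extChartAt_target_mem_nhds (I := 𝓘(ℂ)) p))
  have hd : DifferentiableOn ℂ (fun z => b ((extChartAt 𝓘(ℂ) p).symm z) 1)
      (Metric.ball (extChartAt 𝓘(ℂ) p p) r) := by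
    intro z hz
    have h3 := (mdifferentiableOn_extChartAt_symm (I := 𝓘(ℂ)) z (hball z hz).2).mdifferentiableAt
      ((isOpen_extChartAt_target p).mem_nhds (hball z hz).2)
    have h4 := mdifferentiableAt_iff_differentiableAt.1
      (((hball z hz).1.mdifferentiableAt (by simp)).comp z h3)
    exact (h4.clm_apply (differentiableAt_const (1 : ℂ))).differentiableWithinAt
  obtain ⟨F, hF⟩ := hd.isExactOn_ball
  refine ⟨F ∘ extChartAt 𝓘(ℂ) p, ?_⟩
  filter_upwards [(continuousAt_extChartAt (I := 𝓘(ℂ)) p).eventually (Metric.ball_mem_nhds _ hr),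
    extChartAt_source_mem_nhds (I := 𝓘(ℂ)) p] with q h5 h6
  have h7 := (hF _ h5).hasFDerivAt.hasMFDerivAt
  have h6' : q ∈ (chartAt ℂ p).source := by rwa [extChartAt_source] at h6
  have h8 := HasMFDerivAt.comp q h7 (mdifferentiableAt_extChartAt (I := 𝓘(ℂ)) h6').hasMFDerivAt
  have h9 : α q = (ContinuousLinearMap.toSpanSingleton ℂ
      (b ((extChartAt 𝓘(ℂ) p).symm (extChartAt 𝓘(ℂ) p q)) 1)).comp
        (mfderiv 𝓘(ℂ) 𝓘(ℂ) (extChartAt 𝓘(ℂ) p) q) := by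
    refine ContinuousLinearMap.ext fun v => ?_
    rw [(extChartAt 𝓘(ℂ) p).left_inv h6, ← hbα q h6' v]
    have h10 : ∀ w : ℂ, b q w = w * b q 1 := fun w => by
      have := (b q).map_smul w (1 : ℂ)
      simpa using this
    exact h10 _
  rw [h9]
  exact h8

theorem IsPrimitiveAt.iff {α : HolomorphicOneForm S} {p : S} {f : S → ℂ}
    (hf : IsPrimitiveAt α p f) (g : S → ℂ) :
    IsPrimitiveAt α p g ↔ ∃ c : ℂ, g =ᶠ[𝓝 p] fun q => f q + c := by
  have : IsManifold 𝓘(ℂ) 1 S := IsManifold.of_le (n := ω) le_top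
  constructor
  · intro hg
    obtain ⟨c, hc⟩ := hasMFDerivAt_zero_const (p := p) (h := g - f) (by
      filter_upwards [hf, hg] with q h1 h2
      have h3 := h2.sub h1
      rwa [sub_self] at h3)
    refine ⟨c, ?_⟩
    filter_upwards [hc] with q hq
    rw [← hq, Pi.sub_apply]
    ring
  · rintro ⟨c, hc⟩
    filter_upwards [hf, eventually_eventually_nhds.2 hc] with q h1 h2
    have h3 := h1.add (hasMFDerivAt_const (I := 𝓘(ℂ)) (I' := 𝓘(ℂ)) c q)
    have h4 : HasMFDerivAt 𝓘(ℂ) 𝓘(ℂ) (f + fun _ => c) q (α q) := by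
      have h5 : α q + 0 = α q := add_zero _
      exact h5 ▸ h3
    exact h4.congr_of_eventuallyEq h2

/-- The translation structure of `(S, α)`: its local coordinates are the local primitives. -/
def TranslationStructure.ofForm (α : HolomorphicOneForm S) : TranslationStructure S where
  IsCoord := IsPrimitiveAt α
  exists_coord := exists_isPrimitiveAt α
  isCoord_iff := fun hf g => hf.iff g
  eventually_isCoord := fun hf => eventually_eventually_nhds.2 hf

end Form

/-! ### Translation equivalence and the `SL(2,ℝ)`-orbit -/

/-- A space with a translation structure. -/
structure Surface : Type (u + 1) where
  carrier : Type u
  [top : TopologicalSpace carrier]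
  str : TranslationStructure carrier

attribute [instance] Surface.top

/-- Translation equivalence: a homeomorphism which is a translation in local coordinates. -/
def TranslationEquiv (X Y : Surface.{u}) : Prop :=
  ∃ h : X.carrier ≃ₜ Y.carrier, ∀ (p : X.carrier) (f : X.carrier → ℂ) (g : Y.carrier → ℂ),
    X.str.IsCoord p f → Y.str.IsCoord (h p) g → ∃ c : ℂ, ∀ᶠ q in 𝓝 p, g (h q) = f q + c

instance surfaceSetoid : Setoid Surface.{u} where
  r := TranslationEquiv
  iseqv :=
    { refl := fun X => ⟨Homeomorph.refl _, fun _ _ g hf hg => (X.str.isCoord_iff hf g).1 hg⟩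
      symm := by
        rintro X Y ⟨h, H⟩
        refine ⟨h.symm, fun p g f hg hf => ?_⟩
        obtain ⟨c, hc⟩ := H (h.symm p) f g hf (by simpa using hg)
        refine ⟨-c, ?_⟩
        filter_upwards [h.symm.continuous.continuousAt.eventually hc] with q hq
        rw [Homeomorph.apply_symm_apply] at hq
        rw [hq]
        ring
      trans := by
        rintro X Y Z ⟨h, H⟩ ⟨k, K⟩
        refine ⟨h.trans k, fun p f e hf he => ?_⟩
        obtain ⟨g, hg⟩ := Y.str.exists_coord (h p)
        obtain ⟨c, hc⟩ := H p f g hf hg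
        obtain ⟨c', hc'⟩ := K (h p) g e hg he
        refine ⟨c + c', ?_⟩
        filter_upwards [hc, h.continuous.continuousAt.eventually hc'] with q h1 h2
        rw [Homeomorph.trans_apply, h2, h1]
        ring }

/-- Surfaces up to translation equivalence. -/
def SurfaceClass : Type (u + 1) := Quotient surfaceSetoid.{u}

/-- The class of a space with a translation structure. -/
def toClass {X : Type u} [TopologicalSpace X] (T : TranslationStructure X) : SurfaceClass.{u} :=
  Quotient.mk surfaceSetoid ⟨X, T⟩

instance : SMul SL(2, ℝ) SurfaceClass.{u} where
  smul A := Quotient.map (fun X => ⟨X.carrier, A • X.str⟩) (by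
    rintro X Y ⟨h, H⟩
    refine ⟨h, ?_⟩
    rintro p _ _ ⟨f, hf, rfl⟩ ⟨g, hg, rfl⟩
    obtain ⟨c, hc⟩ := H p f g hf hg
    refine ⟨planeMap A c, ?_⟩
    filter_upwards [hc] with q hq
    simp [hq, planeMap_add])

theorem smul_toClass {X : Type u} [TopologicalSpace X] (A : SL(2, ℝ))
    (T : TranslationStructure X) : A • toClass T = toClass (A • T) := rfl

instance : MulAction SL(2, ℝ) SurfaceClass.{u} where
  one_smul := by
    rintro ⟨X⟩
    exact congrArg (fun T => toClass T) (one_smul SL(2, ℝ) X.str)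
  mul_smul := by
    rintro A B ⟨X⟩
    exact congrArg (fun T => toClass T) (mul_smul A B X.str)

/-- The orbit `𝒪 = {A x : A ∈ SL(2,ℝ)}` in the set of classes of surfaces. -/
def OrbitSpace (x : SurfaceClass.{u}) : Type (u + 1) := MulAction.orbit SL(2, ℝ) x

/-- The parametrization `A ↦ A x` of the orbit. -/
def OrbitSpace.mk (x : SurfaceClass.{u}) (A : SL(2, ℝ)) : OrbitSpace x :=
  ⟨A • x, MulAction.mem_orbit x A⟩

/-- The orbit carries the quotient topology of `SL(2,ℝ)`. -/
instance (x : SurfaceClass.{u}) : TopologicalSpace (OrbitSpace x) :=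
  TopologicalSpace.coinduced (OrbitSpace.mk x) inferInstance

/-! ### Teichmüller trajectories -/

/-- The Teichmüller deformation `gᵗ = diag(e⁻ᵗ, eᵗ)`. -/
def teich (t : ℝ) : SL(2, ℝ) :=
  ⟨!![Real.exp (-t), 0; 0, Real.exp t], by simp [Matrix.det_fin_two, ← Real.exp_add]⟩

/-- `y` is an `ω`-limit point of the trajectory `φ`. -/
def IsOmegaLimit {Y : Type*} [TopologicalSpace Y] (φ : ℝ → Y) (y : Y) : Prop :=
  ∃ t : ℕ → ℝ, Tendsto t atTop atTop ∧ Tendsto (fun n => φ (t n)) atTop (𝓝 y)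

/-- The trajectory `gᵗ x` is non-divergent in the `SL(2,ℝ)`-orbit of `x`. -/
def NonDivergent (x : SurfaceClass.{u}) : Prop :=
  ∃ y : OrbitSpace x, IsOmegaLimit (fun t => OrbitSpace.mk x (teich t)) y

/-! ### Spaces of covers -/

section Covers

variable {S : Type u} [TopologicalSpace S]

/-- A connected surface has infinite topological type when its fundamental group is not finitely
generated. -/
def InfiniteType (S : Type u) [TopologicalSpace S] : Prop :=
  ∀ s : S, ¬ Group.FG (FundamentalGroup S s)

/-- The monodromy representation of a covering map of degree `d`, for a labelling `ℓ` of the fibre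
over the basepoint. (Mathlib multiplies loops in the order for which this is a homomorphism.) -/
def monodromyRep {E : Type u} [TopologicalSpace E] {p : E → S} (hp : IsCoveringMap p) {s₀ : S}
    {d : ℕ} (ℓ : Fin d ≃ p ⁻¹' {s₀}) : FundamentalGroup S s₀ →* Equiv.Perm (Fin d) :=
  (ℓ.symm.permCongrHom : Equiv.Perm (p ⁻¹' {s₀}) →* Equiv.Perm (Fin d)).comp (hp.monodromyPerm s₀)

/-- Covers of degree `d` of `S` with a labelling of the fibre over `s₀` for which the monodromy
representation takes values in `G`. -/
structure LabelledCover (s₀ : S) {d : ℕ} (G : Subgroup (Equiv.Perm (Fin d))) : Type (u + 1) where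
  total : Type u
  [top : TopologicalSpace total]
  proj : total → S
  isCoveringMap : IsCoveringMap proj
  label : Fin d ≃ proj ⁻¹' {s₀}
  monodromy_mem : ∀ γ, monodromyRep isCoveringMap label γ ∈ G

attribute [instance] LabelledCover.top

/-- The topology of pointwise convergence on `Hom(π₁(S, s₀), G)`, with `G` discrete. -/
@[reducible]
def homTopology (s₀ : S) {d : ℕ} (G : Subgroup (Equiv.Perm (Fin d))) :
    TopologicalSpace (FundamentalGroup S s₀ →* G) :=
  TopologicalSpace.induced (fun h γ => h γ)
    (@Pi.topologicalSpace (FundamentalGroup S s₀) (fun _ => G) (fun _ => ⊥))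

variable {s₀ : S} {d : ℕ} {G : Subgroup (Equiv.Perm (Fin d))}

/-- The monodromy representation of a labelled cover, as an element of `Hom(π₁(S, s₀), G)`. -/
def LabelledCover.rep (L : LabelledCover s₀ G) : FundamentalGroup S s₀ →* G :=
  (monodromyRep L.isCoveringMap L.label).codRestrict G L.monodromy_mem

/-- Labelled covers are topologized through their monodromy representations. Every element of
`Hom(π₁(S, s₀), G)` is the monodromy of a labelled cover, and this cover is unique up to
isomorphism, so that quotients of this space by relations coarser than isomorphism of covers are
the corresponding quotients of `Hom(π₁(S, s₀), G)`. -/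
instance : TopologicalSpace (LabelledCover s₀ G) :=
  TopologicalSpace.induced LabelledCover.rep (homTopology s₀ G)

/-- The class of a cover with the translation structure lifted from `S`. -/
def LabelledCover.toClass (T : TranslationStructure S) (L : LabelledCover s₀ G) :
    SurfaceClass.{u} :=
  Flat.toClass (T.lift L.isCoveringMap)

/-- `Cov_G`: covers with monodromy in `G` up to translation equivalence. -/
def Cov (T : TranslationStructure S) (s₀ : S) {d : ℕ} (G : Subgroup (Equiv.Perm (Fin d))) :
    Type (u + 1) :=
  Set.range (LabelledCover.toClass T : LabelledCover s₀ G → SurfaceClass.{u})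

/-- The element of `Cov_G` given by a labelled cover. -/
def Cov.mk (T : TranslationStructure S) (L : LabelledCover s₀ G) : Cov T s₀ G :=
  ⟨L.toClass T, L, rfl⟩

/-- `Cov_G` carries the quotient topology. -/
instance (T : TranslationStructure S) : TopologicalSpace (Cov T s₀ G) :=
  TopologicalSpace.coinduced (Cov.mk T) inferInstance

/-- The space of all `A (S̃, α̃)` with `A ∈ SL(2,ℝ)` and `(S̃, α̃) ∈ Cov_G`, up to translation
equivalence. -/
def CoverOrbitSpace (T : TranslationStructure S) (s₀ : S) {d : ℕ}
    (G : Subgroup (Equiv.Perm (Fin d))) : Type (u + 1) :=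
  Set.range (fun x : SL(2, ℝ) × Cov T s₀ G => x.1 • (x.2.1 : SurfaceClass.{u}))

/-- The parametrization of this space by `SL(2,ℝ) × Cov_G`. -/
def CoverOrbitSpace.mk (T : TranslationStructure S) (x : SL(2, ℝ) × Cov T s₀ G) :
    CoverOrbitSpace T s₀ G :=
  ⟨x.1 • x.2.1, x, rfl⟩

/-- It carries the quotient topology of `SL(2,ℝ) × Cov_G`. -/
instance (T : TranslationStructure S) : TopologicalSpace (CoverOrbitSpace T s₀ G) :=
  TopologicalSpace.coinduced (CoverOrbitSpace.mk T) inferInstance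

end Covers

end Flat

end

universe v

noncomputable section

namespace Flat

/-! ### Homotopy classes of paths in simply connected sets -/

section Within

variable {X : Type*} [TopologicalSpace X]

/-! Write `x` for the class of the base surface and suppose `gᵗⁿ x → A x` in its orbit. The orbit
map is open (`isOpenMap_orbitSpace_mk`), so after passing to a subsequence there are `Rₙ → A` in
`SL(2,ℝ)` with `Rₙ x = gᵗⁿ x` (`NonDivergent.exists_tendsto`). Then `Rₙ⁻¹ gᵗⁿ` fixes `x`, hence
comes from an affine automorphism `hₙ` of the base. Composing the given cover with `hₙ` gives a
cover `Lₙ`, again with monodromy in `G`, such that `gᵗⁿ` applied to the given cover is `Rₙ Lₙ`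
(`LabelledCover.exists_toClass_eq_smul`). If a subsequence of `Lₙ` tends to a cover `L'`, the
trajectory accumulates at `A L'`.

The remaining point is sequential compactness of the space of covers
(`LabelledCover.exists_subseq_tendsto`). As `π₁` is countable and `G` finite, `Hom(π₁, G)` is
sequentially compact. The limit representation has to be the monodromy of an actual cover, which is
glued from simply connected open sets (`exists_isCoveringMap_monodromyPerm_eq`). The same
construction, applied to the regular representation, gives countability of `π₁`. -/

theorem mk_eq_mk_of_isSimplyConnected {U : Set X} (hU : IsSimplyConnected U) {x y : X}
    (γ δ : Path x y) (hγ : ∀ t, γ t ∈ U) (hδ : ∀ t, δ t ∈ U) :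
    Path.Homotopic.Quotient.mk γ = Path.Homotopic.Quotient.mk δ := by
  have := hU.simplyConnectedSpace
  have hx : x ∈ U := by simpa using hγ 0
  have hy : y ∈ U := by simpa using hγ 1
  let lift : ∀ ε : Path x y, (∀ t, ε t ∈ U) → Path (⟨x, hx⟩ : U) ⟨y, hy⟩ := fun ε hε =>
    { toFun := fun t => ⟨ε t, hε t⟩
      continuous_toFun := by fun_prop
      source' := by simp
      target' := by simp }
  exact Path.Homotopic.Quotient.eq.2
    ((SimplyConnectedSpace.paths_homotopic (lift γ hγ) (lift δ hδ)).map ⟨_, continuous_subtype_val⟩)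

open Classical in
/-- The homotopy class of a path from `x` to `y` inside `U`, if there is one. -/
def within [PathConnectedSpace X] (U : Set X) (x y : X) : Path.Homotopic.Quotient x y :=
  if h : JoinedIn U x y then .mk h.somePath else .mk (PathConnectedSpace.somePath x y)

variable [PathConnectedSpace X] {U : Set X}

theorem mk_eq_within (hU : IsSimplyConnected U) {x y : X} (γ : Path x y) (hγ : ∀ t, γ t ∈ U) :
    .mk γ = within U x y := by
  have h : JoinedIn U x y := ⟨γ, hγ⟩
  rw [within, dif_pos h]
  exact mk_eq_mk_of_isSimplyConnected hU _ _ hγ h.somePath_mem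

theorem within_self (hU : IsSimplyConnected U) {x : X} (hx : x ∈ U) : within U x x = .refl x :=
  (mk_eq_within hU (Path.refl x) fun _ => hx).symm

theorem within_trans (hU : IsSimplyConnected U) {x y z : X} (hx : x ∈ U) (hy : y ∈ U)
    (hz : z ∈ U) : (within U x y).trans (within U y z) = within U x z := by
  obtain ⟨γ, hγ⟩ := hU.isPathConnected.joinedIn x hx y hy
  obtain ⟨δ, hδ⟩ := hU.isPathConnected.joinedIn y hy z hz
  rw [← mk_eq_within hU γ hγ, ← mk_eq_within hU δ hδ, ← Path.Homotopic.Quotient.mk_trans]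
  refine mk_eq_within hU _ fun t => ?_
  rw [Path.trans_apply]
  split_ifs
  exacts [hγ _, hδ _]

end Within

/-! ### The cover defined by a representation of the fundamental groupoid -/

/-- An action of the fundamental groupoid of `X` on a set `F`. -/
structure Transport (X : Type*) [TopologicalSpace X] (F : Type*) where
  map : ∀ {x y : X}, Path.Homotopic.Quotient x y → F → F
  map_refl : ∀ (x : X) (v : F), map (Path.Homotopic.Quotient.refl x) v = v
  map_trans : ∀ {x y z : X} (γ : Path.Homotopic.Quotient x y) (δ : Path.Homotopic.Quotient y z)
    (v : F), map (γ.trans δ) v = map δ (map γ v)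

namespace Transport

theorem map_cast {X : Type*} [TopologicalSpace X] {F : Type*} (T : Transport X F) {x y x' y' : X}
    (γ : Path.Homotopic.Quotient x y) (hx : x' = x) (hy : y' = y) (v : F) :
    T.map (γ.cast hx hy) v = T.map γ v := by
  subst hx hy
  rw [Path.Homotopic.Quotient.cast_rfl_rfl]

variable {X : Type*} [TopologicalSpace X] [PathConnectedSpace X] [LocallyPathConnectedSpace X]
  {F : Type*} [TopologicalSpace F] [DiscreteTopology F]

/-- The transition functions, over simply connected open sets, of the cover with fibre `F` whose
monodromy is a given action of the fundamental groupoid. -/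
def core (T : Transport X F) (U : X → Set X) (hUo : ∀ x, IsOpen (U x))
    (hU : ∀ x, IsSimplyConnected (U x)) (hmem : ∀ x, x ∈ U x) : FiberBundleCore X X F where
  baseSet := U
  isOpen_baseSet := hUo
  indexAt := id
  mem_baseSet_at := hmem
  coordChange i j x v := T.map (within (U j) x j) (T.map (within (U i) i x) v)
  coordChange_self i x hx v := by
    rw [← T.map_trans, within_trans (hU i) (hmem i) hx (hmem i), within_self (hU i) (hmem i),
      T.map_refl]
  continuousOn_coordChange i j := by
    rintro ⟨x, v⟩ ⟨⟨hi, hj⟩, -⟩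
    refine ContinuousAt.continuousWithinAt ?_
    obtain ⟨W, ⟨hW, hWc⟩, hWU⟩ := (path_connected_basis x).mem_iff.1
      (((hUo i).inter (hUo j)).mem_nhds ⟨hi, hj⟩)
    -- The transition is locally constant in the base point: `x` is joined to a nearby `y` by a path
    -- in both sets, and running along it in `U i` and back in `U j` cancels.
    refine (continuousAt_const (y := T.map (within (U j) x j) (T.map (within (U i) i x) v))).congr ?_
    have hv : ∀ᶠ q : X × F in 𝓝 (x, v), q.2 = v :=
      continuousAt_snd.eventually ((isOpen_discrete {v}).mem_nhds (Set.mem_singleton v))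
    filter_upwards [hv, continuousAt_fst.eventually hW] with q hq hqW
    obtain ⟨y, w⟩ := q
    obtain rfl : w = v := hq
    obtain ⟨γ, hγ⟩ := hWc.joinedIn x (mem_of_mem_nhds hW) y hqW
    have hy := hWU hqW
    have hxy : within (U i) x y = within (U j) x y := by
      rw [← mk_eq_within (hU i) γ fun t => (hWU (hγ t)).1,
        mk_eq_within (hU j) γ fun t => (hWU (hγ t)).2]
    rw [← within_trans (hU i) (hmem i) hi hy.1, hxy, T.map_trans,
      ← T.map_trans (within (U j) x y), within_trans (hU j) hj hy.2 (hmem j)]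
  coordChange_comp i j k x hx v := by
    rw [← T.map_trans (within (U j) x j), within_trans (hU j) hx.1.2 (hmem j) hx.1.2,
      within_self (hU j) hx.1.2, T.map_refl]

section Core

variable (T : Transport X F) (U : X → Set X) (hUo : ∀ x, IsOpen (U x))
    (hU : ∀ x, IsSimplyConnected (U x)) (hmem : ∀ x, x ∈ U x)

theorem isCoveringMap_proj : IsCoveringMap (T.core U hUo hU hmem).proj :=
  FiberBundle.isCoveringMap (F := F) (E := (T.core U hUo hU hmem).Fiber)

/-- This is the explicit lift of `γ` starting at `v`. In the trivialization over `U (γ t₀)` its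
fibre coordinate is constant near `t₀`: the short arc from `γ t₀` to `γ t` cancels against the
return inside that simply connected set. -/
theorem continuous_transport_subpath {x y : X} (γ : Path x y) (v : F) :
    Continuous fun t => (⟨γ t, T.map (.mk (γ.subpath 0 t)) v⟩ :
      (T.core U hUo hU hmem).TotalSpace) := by
  refine continuous_iff_continuousAt.2 fun t₀ => ?_
  refine (FiberBundle.continuousAt_totalSpace F _).2 ⟨γ.continuous.continuousAt, ?_⟩
  refine (continuousAt_const (y := T.map (.mk (γ.subpath 0 t₀)) v)).congr ?_
  -- The whole arc between the two times must stay in `U (γ t₀)`, not just its endpoint.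
  have h1 : ∀ᶠ t in 𝓝 t₀, ∀ s ∈ Set.uIcc t₀ t, γ s ∈ U (γ t₀) := by
    have h := ((tendsto_const_nhds (x := t₀)).uIcc (tendsto_id (α := unitInterval) (x := 𝓝 t₀)))
    exact tendsto_smallSets_iff.1 h _
      (γ.continuous.continuousAt.preimage_mem_nhds ((hUo _).mem_nhds (hmem _)))
  filter_upwards [h1] with t ht
  change _ = T.map (within (U (γ t₀)) (γ t) (γ t₀)) (T.map (within (U (γ t)) (γ t) (γ t))
    (T.map (.mk (γ.subpath 0 t)) v))
  have h2 : Path.Homotopic.Quotient.mk (γ.subpath 0 t) =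
      (Path.Homotopic.Quotient.mk (γ.subpath 0 t₀)).trans (.mk (γ.subpath t₀ t)) := by
    rw [← Path.Homotopic.Quotient.mk_trans]
    exact (Path.Homotopic.Quotient.eq.2 ⟨Path.Homotopy.subpathTransSubpath γ 0 t₀ t⟩).symm
  have h3 : Path.Homotopic.Quotient.mk (γ.subpath t₀ t) = within (U (γ t₀)) (γ t₀) (γ t) := by
    refine mk_eq_within (hU _) _ fun s => ?_
    have : γ.subpath t₀ t s ∈ γ '' Set.uIcc t₀ t := by
      rw [← Path.range_subpath]
      exact ⟨s, rfl⟩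
    obtain ⟨r, hr, hrs⟩ := this
    exact hrs ▸ ht r hr
  rw [within_self (hU _) (hmem _), T.map_refl, h2, h3, T.map_trans, ← T.map_trans (within _ _ _),
    within_trans (hU _) (hmem _) (ht t Set.right_mem_uIcc) (hmem _), within_self (hU _) (hmem _),
    T.map_refl]

/-- By uniqueness of lifts, the path of `continuous_transport_subpath` is the lift that defines the
monodromy. -/
theorem monodromy_core {x y : X} (γ : Path.Homotopic.Quotient x y) (v : F) :
    (T.isCoveringMap_proj U hUo hU hmem).monodromy γ ⟨⟨x, v⟩, rfl⟩ = ⟨⟨y, T.map γ v⟩, rfl⟩ := by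
  induction γ with | mk γ =>
  refine Subtype.ext ?_
  have hp := T.isCoveringMap_proj U hUo hU hmem
  have h1 := (hp.eq_liftPath_iff (γ := (γ : C(unitInterval, X)))
    (e := (⟨x, v⟩ : (T.core U hUo hU hmem).TotalSpace)) γ.source).2
    ⟨T.continuous_transport_subpath U hUo hU hmem γ v, rfl, by
      refine Bundle.TotalSpace.ext γ.source (heq_of_eq ?_)
      rw [Path.subpath_self, Path.Homotopic.Quotient.mk_refl, T.map_refl]⟩
  have h2 := congrFun h1 1
  refine h2.symm.trans (Bundle.TotalSpace.ext γ.target (heq_of_eq ?_))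
  rw [Path.subpath_zero_one, Path.Homotopic.Quotient.mk_cast, T.map_cast]

end Core

end Transport

/-! ### Realizing permutation representations of `π₁`, and countability of `π₁` -/

section Representation

variable {X : Type u} [TopologicalSpace X] [PathConnectedSpace X]

/-- A class of paths from a basepoint to a given point. -/
def connectingPath (s₀ x : X) : Path.Homotopic.Quotient s₀ x :=
  .mk (PathConnectedSpace.somePath s₀ x)

/-- The loop at `s₀` obtained from a path by joining its ends to `s₀`. -/
def closeUp (s₀ : X) {x y : X} (γ : Path.Homotopic.Quotient x y) : FundamentalGroup X s₀ :=
  ((connectingPath s₀ x).trans γ).trans (connectingPath s₀ y).symm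

theorem closeUp_refl (s₀ x : X) : closeUp s₀ (.refl x) = 1 := by
  rw [closeUp, Path.Homotopic.Quotient.trans_refl, Path.Homotopic.Quotient.trans_symm]
  rfl

/-- The two copies of the connecting path to `y` cancel. The order is reversed because a product of
loops runs its right factor first. -/
theorem closeUp_trans (s₀ : X) {x y z : X} (γ : Path.Homotopic.Quotient x y)
    (δ : Path.Homotopic.Quotient y z) :
    closeUp s₀ (γ.trans δ) = closeUp s₀ δ * closeUp s₀ γ := by
  rw [FundamentalGroup.mul_def]
  simp only [closeUp]
  grind

/-- The action of the fundamental groupoid extending a representation of the fundamental group. -/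
def Transport.ofRep {F : Type*} {s₀ : X} (ρ : FundamentalGroup X s₀ →* Equiv.Perm F) :
    Transport X F where
  map γ := ρ (closeUp s₀ γ)
  map_refl x v := by rw [closeUp_refl, map_one, Equiv.Perm.one_apply]
  map_trans γ δ v := by rw [closeUp_trans, map_mul, Equiv.Perm.mul_apply]

/-- Every permutation representation of the fundamental group is the monodromy of a cover. -/
theorem exists_isCoveringMap_monodromyPerm_eq [LocallyPathConnectedSpace X]
    (hX : ∀ x : X, ∃ U, IsOpen U ∧ IsSimplyConnected U ∧ x ∈ U) (s₀ : X) {F : Type v}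
    (ρ : FundamentalGroup X s₀ →* Equiv.Perm F) :
    ∃ (E : Type (max u v)) (_ : TopologicalSpace E) (p : E → X) (hp : IsCoveringMap p)
      (ℓ : F ≃ p ⁻¹' {s₀}), ∀ γ i, hp.monodromyPerm s₀ γ (ℓ i) = ℓ (ρ γ i) := by
  let _ : TopologicalSpace F := ⊥
  have : DiscreteTopology F := ⟨rfl⟩
  choose U hUo hU hmem using hX
  let T := Transport.ofRep ρ
  -- The chosen path from `s₀` to itself need not be trivial, so closing up a loop at `s₀`
  -- conjugates it by `τ`. Labelling the fibre through `(ρ τ)⁻¹` undoes this.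
  let τ : FundamentalGroup X s₀ := connectingPath s₀ s₀
  let fib : F ≃ (T.core U hUo hU hmem).proj ⁻¹' {s₀} :=
    { toFun := fun v => ⟨⟨s₀, v⟩, rfl⟩
      invFun := fun e => e.1.2
      left_inv := fun v => rfl
      right_inv := by
        rintro ⟨⟨x, v⟩, hx⟩
        obtain rfl : x = s₀ := hx
        rfl }
  refine ⟨_, _, _, T.isCoveringMap_proj U hUo hU hmem, (ρ τ)⁻¹.trans fib, fun γ i => ?_⟩
  refine (T.monodromy_core U hUo hU hmem γ ((ρ τ)⁻¹ i)).trans ?_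
  refine congrArg fib ?_
  change ρ (τ⁻¹ * (γ * τ)) ((ρ τ)⁻¹ i) = (ρ τ)⁻¹ (ρ γ i)
  rw [map_mul, map_mul, map_inv, Equiv.Perm.mul_apply, Equiv.Perm.mul_apply,
    ← Equiv.Perm.mul_apply (ρ τ), mul_inv_cancel, Equiv.Perm.one_apply]

/-- Take the cover whose monodromy is left translation of `π₁` on itself. Its fibre is discrete, and
it is a continuous image of the space of loops, which is second countable; a separable discrete
space is countable. -/
theorem countable_fundamentalGroup [SecondCountableTopology X] [LocallyPathConnectedSpace X]
    (hX : ∀ x : X, ∃ U, IsOpen U ∧ IsSimplyConnected U ∧ x ∈ U) (s₀ : X) :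
    Countable (FundamentalGroup X s₀) := by
  obtain ⟨E, _, p, hp, ℓ, hℓ⟩ := exists_isCoveringMap_monodromyPerm_eq hX s₀
    (MulAction.toPermHom (FundamentalGroup X s₀) (FundamentalGroup X s₀))
  let Ω := {γ : C(unitInterval, X) // γ 0 = s₀ ∧ γ 1 = s₀}
  -- All loops are lifted at once, as a homotopy parametrized by `Ω`, so that the endpoint of the
  -- lift depends continuously on the loop.
  let H : C(unitInterval × Ω, X) := ⟨fun q => q.2.1 q.1,
    (continuous_subtype_val.comp continuous_snd).eval continuous_fst⟩
  let e₀ : E := ℓ 1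
  have he₀ : p e₀ = s₀ := (ℓ 1).2
  have H₀ : ∀ γ : Ω, H (0, γ) = p (ContinuousMap.const Ω e₀ γ) := fun γ => γ.2.1.trans he₀.symm
  let Φ : Ω → p ⁻¹' {s₀} := fun γ => ⟨hp.liftHomotopy H (.const Ω e₀) H₀ (1, γ),
    (congrFun (hp.liftHomotopy_lifts H (.const Ω e₀) H₀) (1, γ)).trans γ.2.2⟩
  have hΦ : Continuous Φ := by fun_prop
  have : DiscreteTopology (p ⁻¹' {s₀}) := (hp s₀).1
  have hsurj : Function.Surjective (ℓ.symm ∘ Φ) := by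
    intro g
    obtain ⟨γ, hγ⟩ := Path.Homotopic.Quotient.mk_surjective g.toPath
    refine ⟨⟨γ, γ.source, γ.target⟩, ?_⟩
    rw [Function.comp_apply, Equiv.symm_apply_eq]
    -- The lift of a loop in the class `g` starting at the label `1` ends at the label `g * 1 = g`,
    -- so every label is reached.
    have h1 := hℓ g 1
    have h2 : MulAction.toPermHom (FundamentalGroup X s₀) (FundamentalGroup X s₀) g 1 = g :=
      mul_one g
    rw [h2] at h1
    rw [← h1]
    refine Subtype.ext ?_
    change _ = (hp.monodromy g.toPath (ℓ 1)).1
    rw [← hγ]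
    rfl
  have hcount : Countable (p ⁻¹' {s₀}) := by
    have hs : Function.Surjective Φ := (Equiv.comp_surjective Φ ℓ.symm).1 hsurj
    have : SecondCountableTopology Ω := TopologicalSpace.Subtype.secondCountableTopology _
    have := hs.denseRange.separableSpace hΦ
    exact TopologicalSpace.separableSpace_iff_countable.1 this
  exact ℓ.injective.countable

end Representation

theorem exists_isOpen_isSimplyConnected {S : Type*} [TopologicalSpace S] [ChartedSpace ℂ S]
    (x : S) : ∃ U : Set S, IsOpen U ∧ IsSimplyConnected U ∧ x ∈ U := by
  let e := chartAt ℂ x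
  obtain ⟨r, hr, hball⟩ := Metric.isOpen_iff.1 e.open_target (e x) (mem_chart_target ℂ x)
  refine ⟨e.symm '' Metric.ball (e x) r, e.symm.isOpen_image_of_subset_source Metric.isOpen_ball
    hball, ?_, e x, Metric.mem_ball_self hr, e.left_inv (mem_chart_source ℂ x)⟩
  have : ContractibleSpace (Metric.ball (e x) r) :=
    (convex_ball (e x) r).contractibleSpace ⟨_, Metric.mem_ball_self hr⟩
  have h : Metric.ball (e x) r ≃ₜ e.symm '' Metric.ball (e x) r :=
    e.symm.homeomorphOfImageSubsetSource hball rfl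
  have h2 : SimplyConnectedSpace (Metric.ball (e x) r) := inferInstance
  exact h.toHomotopyEquiv.simplyConnectedSpace_iff.1 h2

/-! ### Composing a cover with a homeomorphism of the base -/

section Comp

variable {S : Type u} [TopologicalSpace S] {E : Type u} [TopologicalSpace E] {p : E → S}

/-- The identity of `E` is a translation equivalence: up to constants, coordinates of `A • T` are
coordinates of `T` composed with `h`. -/
theorem smul_toClass_lift {T : TranslationStructure S} {A : SL(2, ℝ)} (h : S ≃ₜ S)
    (H : ∀ (q : S) (f g : S → ℂ), (A • T).IsCoord q f → T.IsCoord (h q) g →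
      ∃ c : ℂ, ∀ᶠ r in 𝓝 q, g (h r) = f r + c)
    (hp : IsCoveringMap p) :
    A • toClass (T.lift hp) = toClass (T.lift (hp.homeomorph_comp h)) := by
  refine Quotient.sound ⟨Homeomorph.refl E, ?_⟩
  rintro e _ g ⟨f', ⟨f, hf, hf'⟩, rfl⟩ ⟨k, hk, hg⟩
  obtain ⟨c, hc⟩ := H (p e) (planeMap A ∘ f) k ⟨f, hf, rfl⟩ hk
  refine ⟨c, ?_⟩
  filter_upwards [hf', hg, hp.continuous.continuousAt.eventually hc] with q h1 h2 h3
  exact h2.trans (h3.trans (by simp [h1]))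

/-- A lift of `γ` through `h ∘ p` is the same thing as a lift of `h⁻¹ ∘ γ` through `p`. -/
theorem coe_monodromy_homeomorph_comp (hp : IsCoveringMap p) (h : S ≃ₜ S) {x y : S}
    (γ : Path.Homotopic.Quotient x y) (e : (h ∘ p) ⁻¹' {x}) (he : e.1 ∈ p ⁻¹' {h.symm x}) :
    ((hp.homeomorph_comp h).monodromy γ e : E) =
      hp.monodromy (γ.map ⟨h.symm, h.symm.continuous⟩) ⟨e.1, he⟩ := by
  induction γ with | mk γ =>
  have hh := hp.homeomorph_comp h
  have h0 : (γ : C(unitInterval, S)) 0 = (h ∘ p) e.1 := γ.source.trans e.2.symm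
  have h0' : ((γ.map h.symm.continuous : Path _ _) : C(unitInterval, S)) 0 = p e.1 :=
    (γ.map h.symm.continuous).source.trans he.symm
  have h1 := (hh.eq_liftPath_iff' (Γ := hp.liftPath (γ.map h.symm.continuous) e.1 h0') h0).2
    ⟨by
      rw [Function.comp_assoc, hp.liftPath_lifts]
      ext t
      simp, hp.liftPath_zero _ _ h0'⟩
  exact congrArg (fun Γ : C(unitInterval, E) => Γ 1) h1.symm

/-- The monodromy of a cover composed with a homeomorphism of the base: for a suitable labelling of
its fibre, its monodromy representation factors through the one of the original cover. -/
theorem exists_label_homeomorph_comp [PathConnectedSpace S] (hp : IsCoveringMap p) (h : S ≃ₜ S)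
    {s₀ : S} {d : ℕ} (ℓ : Fin d ≃ p ⁻¹' {s₀}) :
    ∃ ℓ' : Fin d ≃ (h ∘ p) ⁻¹' {s₀}, ∀ γ, ∃ δ,
      monodromyRep (hp.homeomorph_comp h) ℓ' γ = monodromyRep hp ℓ δ := by
  -- The fibre of `h ∘ p` over `s₀` is that of `p` over `h⁻¹ s₀`, so the labelling is transported
  -- along `δ`. The monodromy of `γ` then becomes that of the loop `δ · h⁻¹(γ) · δ⁻¹` at `s₀`.
  let δ : Path.Homotopic.Quotient s₀ (h.symm s₀) := .mk (PathConnectedSpace.somePath _ _)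
  let m := Equiv.ofBijective _ (hp.monodromy_bijective δ)
  have hset : p ⁻¹' {h.symm s₀} = (h ∘ p) ⁻¹' {s₀} := by
    ext e
    simp [Homeomorph.eq_symm_apply]
  refine ⟨(ℓ.trans m).trans (Equiv.setCongr hset), fun γ =>
    ⟨(δ.trans (γ.toPath.map ⟨h.symm, h.symm.continuous⟩)).trans δ.symm, ?_⟩⟩
  ext1 i
  refine (Equiv.symm_apply_eq ((ℓ.trans m).trans (Equiv.setCongr hset))).2 (Subtype.ext ?_)
  let v := hp.monodromy δ (ℓ i)
  refine (coe_monodromy_homeomorph_comp hp h γ ⟨v.1, hset ▸ v.2⟩ v.2).trans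
    (congrArg Subtype.val ?_)
  change _ = m (ℓ (ℓ.symm (hp.monodromy ((δ.trans (γ.toPath.map
    ⟨h.symm, h.symm.continuous⟩)).trans δ.symm) (ℓ i))))
  rw [Equiv.apply_symm_apply, hp.monodromy_trans_apply, hp.monodromy_trans_apply]
  have hδ : ∀ w, hp.monodromy δ (hp.monodromy δ.symm w) = w := fun w => by
    rw [← hp.monodromy_trans_apply, Path.Homotopic.Quotient.symm_trans, hp.monodromy_refl, id]
  exact (hδ _).symm

end Comp

/-! ### The orbit space -/

/-- The saturation of an open set is a union of its right translates by the stabilizer. No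
closedness or discreteness of the stabilizer is needed. -/
theorem isOpenMap_orbitSpace_mk (x : SurfaceClass.{u}) : IsOpenMap (OrbitSpace.mk x) := by
  intro V hV
  refine isOpen_coinduced.2 ?_
  have h : OrbitSpace.mk x ⁻¹' (OrbitSpace.mk x '' V) =
      ⋃ B ∈ MulAction.stabilizer SL(2, ℝ) x, (· * B) ⁻¹' V := by
    ext A
    simp only [Set.mem_preimage, Set.mem_image, Set.mem_iUnion, MulAction.mem_stabilizer_iff]
    constructor
    · rintro ⟨C, hC, hCA⟩
      have h1 : C • x = A • x := congrArg Subtype.val hCA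
      exact ⟨A⁻¹ * C, by rw [mul_smul, h1, inv_smul_smul], by simpa using hC⟩
    · rintro ⟨B, hB, hAB⟩
      exact ⟨A * B, hAB, Subtype.ext (by change (A * B) • x = A • x; rw [mul_smul, hB])⟩
  rw [h]
  exact isOpen_biUnion fun B _ => hV.preimage (continuous_mul_const B)

/-- A non-divergent Teichmüller trajectory can be corrected by elements of the stabilizer so as to
converge in `SL(2,ℝ)`. -/
theorem NonDivergent.exists_tendsto {x : SurfaceClass.{u}} (h : NonDivergent x) :
    ∃ (t : ℕ → ℝ) (R : ℕ → SL(2, ℝ)) (A : SL(2, ℝ)), Tendsto t atTop atTop ∧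
      Tendsto R atTop (𝓝 A) ∧ ∀ n, ((R n)⁻¹ * teich (t n)) • x = x := by
  obtain ⟨⟨_, A, rfl⟩, t, ht, hty⟩ := h
  have : FirstCountableTopology (Matrix (Fin 2) (Fin 2) ℝ) :=
    inferInstanceAs (FirstCountableTopology (Fin 2 → Fin 2 → ℝ))
  have : FirstCountableTopology SL(2, ℝ) :=
    Matrix.SpecialLinearGroup.isClosedEmbedding_val.isInducing.firstCountableTopology
  obtain ⟨V, hV⟩ := (𝓝 A).exists_antitone_basis
  -- By openness the image of each basic neighbourhood `V k` of `A` is a neighbourhood of the limit.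
  -- Choosing `R k` in `V k` along a subsequence forces `R → A`.
  have h1 : ∀ k, ∀ᶠ n in atTop, ∃ R ∈ V k, OrbitSpace.mk x R = OrbitSpace.mk x (teich (t n)) :=
    fun k => hty.eventually ((isOpenMap_orbitSpace_mk x).image_mem_nhds (hV.1.mem_of_mem trivial))
  obtain ⟨φ, hφ, hR⟩ := extraction_forall_of_eventually h1
  choose R hRV hR using hR
  refine ⟨t ∘ φ, R, A, ht.comp hφ.tendsto_atTop, hV.tendsto hRV, fun n => ?_⟩
  have h2 : R n • x = teich (t (φ n)) • x := congrArg Subtype.val (hR n)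
  rw [mul_smul, Function.comp_apply, ← h2, inv_smul_smul]

/-! ### Limits of covers -/

section Limits

/-- Sequential compactness of the space of homomorphisms from a countable group to a finite one. -/
theorem exists_subseq_eventually_eq {Γ : Type*} [Group Γ] [Countable Γ] {H : Type*} [Group H]
    [Finite H] (ρ : ℕ → Γ →* H) :
    ∃ (ρ' : Γ →* H) (φ : ℕ → ℕ), StrictMono φ ∧ ∀ γ, ∀ᶠ n in atTop, ρ (φ n) γ = ρ' γ := by
  let _ : TopologicalSpace H := ⊥
  have : DiscreteTopology H := ⟨rfl⟩
  obtain ⟨a, φ, hφ, ha⟩ := CompactSpace.tendsto_subseq fun n => (ρ n : Γ → H)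
  have h : ∀ γ, ∀ᶠ n in atTop, ρ (φ n) γ = a γ := fun γ =>
    ((tendsto_pi_nhds.1 ha) γ).eventually ((isOpen_discrete {a γ}).mem_nhds (Set.mem_singleton _))
  -- The pointwise limit is multiplicative: it agrees with one and the same `ρ (φ n)` at `γ`, `δ`
  -- and `γ * δ`.
  refine ⟨MonoidHom.mk' a fun γ δ => ?_, φ, hφ, h⟩
  obtain ⟨n, h1, h2, h3⟩ := ((h γ).and ((h δ).and (h (γ * δ)))).exists
  rw [← h1, ← h2, ← h3, map_mul]

variable {S : Type u} [TopologicalSpace S] {s₀ : S} {d : ℕ} {G : Subgroup (Equiv.Perm (Fin d))}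

theorem LabelledCover.exists_rep_eq [PathConnectedSpace S] [LocallyPathConnectedSpace S]
    (hS : ∀ x : S, ∃ U, IsOpen U ∧ IsSimplyConnected U ∧ x ∈ U)
    (ρ : FundamentalGroup S s₀ →* G) : ∃ L : LabelledCover s₀ G, L.rep = ρ := by
  obtain ⟨E, _, p, hp, ℓ, hℓ⟩ := exists_isCoveringMap_monodromyPerm_eq hS s₀ (G.subtype.comp ρ)
  have h : ∀ γ, monodromyRep hp ℓ γ = ρ γ := by
    intro γ
    ext1 i
    exact (Equiv.symm_apply_eq ℓ).2 (hℓ γ i)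
  exact ⟨⟨E, p, hp, ℓ, fun γ => h γ ▸ (ρ γ).2⟩, MonoidHom.ext fun γ => Subtype.ext (h γ)⟩

theorem LabelledCover.tendsto_of_eventually_eq {L : ℕ → LabelledCover s₀ G}
    {L' : LabelledCover s₀ G} (h : ∀ γ, ∀ᶠ n in atTop, (L n).rep γ = L'.rep γ) :
    Tendsto L atTop (𝓝 L') := by
  let _ : TopologicalSpace G := ⊥
  let _ : TopologicalSpace (FundamentalGroup S s₀ →* G) := homTopology s₀ G
  rw [nhds_induced, tendsto_comap_iff, nhds_induced, tendsto_comap_iff]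
  refine tendsto_pi_nhds.2 fun γ => ?_
  exact tendsto_const_nhds.congr' ((h γ).mono fun n hn => hn.symm)

theorem LabelledCover.exists_subseq_tendsto [PathConnectedSpace S] [LocallyPathConnectedSpace S]
    [SecondCountableTopology S] (hS : ∀ x : S, ∃ U, IsOpen U ∧ IsSimplyConnected U ∧ x ∈ U)
    (L : ℕ → LabelledCover s₀ G) :
    ∃ (L' : LabelledCover s₀ G) (φ : ℕ → ℕ), StrictMono φ ∧ Tendsto (L ∘ φ) atTop (𝓝 L') := by
  have := countable_fundamentalGroup hS s₀
  obtain ⟨ρ, φ, hφ, h⟩ := exists_subseq_eventually_eq fun n => (L n).rep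
  obtain ⟨L', rfl⟩ := LabelledCover.exists_rep_eq hS ρ
  exact ⟨L', φ, hφ, LabelledCover.tendsto_of_eventually_eq h⟩

theorem continuous_coverOrbitSpace_mk (T : TranslationStructure S) :
    Continuous fun q : SL(2, ℝ) × LabelledCover s₀ G => CoverOrbitSpace.mk T (q.1, Cov.mk T q.2) := by
  have h1 : Continuous (CoverOrbitSpace.mk T (s₀ := s₀) (G := G)) := continuous_coinduced_rng
  have h2 : Continuous (Cov.mk T (s₀ := s₀) (G := G)) := continuous_coinduced_rng
  exact h1.comp (continuous_fst.prodMk (h2.comp continuous_snd))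

/-- An affine automorphism of the base carries covers to covers. -/
theorem LabelledCover.exists_toClass_eq_smul [PathConnectedSpace S] {T : TranslationStructure S}
    {A : SL(2, ℝ)} (hA : A • Flat.toClass T = Flat.toClass T) (L : LabelledCover s₀ G) :
    ∃ L' : LabelledCover s₀ G, L'.toClass T = A • L.toClass T := by
  obtain ⟨h, H⟩ := Quotient.exact hA
  obtain ⟨ℓ, hℓ⟩ := exists_label_homeomorph_comp L.isCoveringMap h L.label
  refine ⟨⟨L.total, h ∘ L.proj, L.isCoveringMap.homeomorph_comp h, ℓ, fun γ => ?_⟩,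
    (smul_toClass_lift h H L.isCoveringMap).symm⟩
  obtain ⟨δ, hδ⟩ := hℓ γ
  exact hδ ▸ L.monodromy_mem δ

end Limits

end Flat

end

theorem mainTheorem7 {S : Type u} [TopologicalSpace S] [T2Space S] [SecondCountableTopology S]
    [ConnectedSpace S] [ChartedSpace ℂ S] [IsManifold 𝓘(ℂ) ω S]
    (α : Flat.HolomorphicOneForm S) (hα : α ≠ 0)
    (harea : (Flat.TranslationStructure.ofForm α).area < ⊤)
    (htype : Flat.InfiniteType S)
    (hnd : Flat.NonDivergent (Flat.toClass (Flat.TranslationStructure.ofForm α)))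
    (s₀ : S) (d : ℕ) (hd : 2 ≤ d) (G : Subgroup (Equiv.Perm (Fin d)))
    (E : Type u) [TopologicalSpace E] (p : E → S) (hp : IsCoveringMap p)
    (ℓ : Fin d ≃ p ⁻¹' {s₀}) (hG : ∀ γ, Flat.monodromyRep hp ℓ γ ∈ G) :
    ∃ y : Flat.CoverOrbitSpace (Flat.TranslationStructure.ofForm α) s₀ G,
      Flat.IsOmegaLimit
        (fun t => Flat.CoverOrbitSpace.mk (Flat.TranslationStructure.ofForm α)
          (Flat.teich t, Flat.Cov.mk (Flat.TranslationStructure.ofForm α)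
            { total := E, proj := p, isCoveringMap := hp, label := ℓ, monodromy_mem := hG }))
        y := by
  have : LocallyPathConnectedSpace S := ChartedSpace.locallyPathConnectedSpace ℂ S
  have : PathConnectedSpace S := pathConnectedSpace_iff_connectedSpace.2 inferInstance
  obtain ⟨t, R, A, ht, hR, hx⟩ := hnd.exists_tendsto
  generalize Flat.TranslationStructure.ofForm α = T at *
  let L₀ : Flat.LabelledCover s₀ G := ⟨E, p, hp, ℓ, hG⟩
  -- `L n` represents `Rₙ⁻¹ gᵗⁿ` applied to the given cover, so `gᵗⁿ L₀` and `Rₙ Lₙ` are the same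
  -- point, now with both factors under control.
  choose L hL using fun n => L₀.exists_toClass_eq_smul (hx n)
  obtain ⟨L', φ, hφ, hL'⟩ :=
    Flat.LabelledCover.exists_subseq_tendsto Flat.exists_isOpen_isSimplyConnected L
  refine ⟨Flat.CoverOrbitSpace.mk T (A, Flat.Cov.mk T L'), t ∘ φ, ht.comp hφ.tendsto_atTop, ?_⟩
  refine (((Flat.continuous_coverOrbitSpace_mk T).tendsto (A, L')).comp
    ((hR.comp hφ.tendsto_atTop).prodMk_nhds hL')).congr fun n => Subtype.ext ?_
  change R (φ n) • (L (φ n)).toClass T = Flat.teich (t (φ n)) • L₀.toClass T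
  rw [hL, ← mul_smul, mul_inv_cancel_left]
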